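/- Let $k\ge 1$ and $n,m,d\ge 0$ be integers. Let $\Delta_{k,n}$ be the set of all conditional probability distributions $p(y|x)$ of $y\in\{0,1\}^n$ given $x\in\{0,1\}^k$, and let $$C_{k,n}(d)=\{p\in\Delta_{k,n} : |\{(x,y) : p(y|x)>0\}|\le 2^k+d\}.$$ Let $\mathrm{RBM}^k_{n,m}\subseteq\Delta_{k,n}$ be the conditional restricted Boltzmann machine (CRBM) with $k$ input, $n$ output and $m$ hidden units, i.e. the set of all conditional distributions of the form $$p(y|x)=\frac{\sum_{z\in\{0,1\}^m}\exp(z^\top Vx+z^\top Wy+b^\top y+c^\top z)}{\sum_{y'\in\{0,1\}^n}\sum_{z\in\{0,1\}^m}\exp(z^\top Vx+z^\top Wy'+b^\top y'+c^\top z)},\qquad x\in\{0,1\}^k,\ y\in\{0,1\}^n,$$ with $V\in\mathbb R^{m\times k}$, $W\in\mathbb R^{m\times n}$, $b\in\mathbb R^n$, $c\in\mathbb R^m$. **Proposition.** Suppose that $2^k$ divides $d$ and $m\ge d/2$. Then $\mathrm{RBM}^k_{n,m}$ approximates arbitrarily well every $p\in C_{k,n}(d)$ for which the set $\{y\in\{0,1\}^n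 : p(y|x)>0\}$ is the same for all $x\in\{0,1\}^k$; that is, for every such $p$ and every $\varepsilon>0$ there is a $q\in\mathrm{RBM}^k_{n,m}$ with $\sum_{y}|q(y|x)-p(y|x)|\le\varepsilon$ for all $x\in\{0,1\}^k$. -/

import Mathlib

open scoped BigOperators Matrix

noncomputable section

/-- The state space `{0,1}^N`. -/
abbrev BinState (N : ℕ) : Type := Fin N → Bool

/-- A binary state, read as a real column vector with entries `0` and `1`. -/
def BinState.toVec {N : ℕ} (x : BinState N) : Fin N → ℝ :=
  fun i => if x i then 1 else 0

/-- The polytope `Δ_{k,n}` of conditional distributions `p(y|x)` of `y ∈ {0,1}^n` given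
`x ∈ {0,1}^k`; the entry `p(y|x)` is written `p x y`. -/
def condPolytope (k n : ℕ) : Set (BinState k → BinState n → ℝ) :=
  {p | ∀ x, (∀ y, 0 ≤ p x y) ∧ ∑ y, p x y = 1}

/-- The unnormalized weight
`∑_{z ∈ {0,1}^m} exp (zᵀ V x + zᵀ W y + bᵀ y + cᵀ z)`. -/
def crbmWeight {k n m : ℕ} (V : Matrix (Fin m) (Fin k) ℝ) (W : Matrix (Fin m) (Fin n) ℝ)
    (b : Fin n → ℝ) (c : Fin m → ℝ) (x : BinState k) (y : BinState n) : ℝ :=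
  ∑ z : BinState m,
    Real.exp (z.toVec ⬝ᵥ (V *ᵥ x.toVec) + z.toVec ⬝ᵥ (W *ᵥ y.toVec) + b ⬝ᵥ y.toVec
      + c ⬝ᵥ z.toVec)

/-- The conditional restricted Boltzmann machine with `k` input, `n` output and `m` hidden
units: the set of conditional distributions `p(y|x)` that are obtained from some choice of
weights `V`, `W` and biases `b`, `c` by normalizing `crbmWeight` over `y`, for each `x`. -/
def CRBM (k n m : ℕ) : Set (BinState k → BinState n → ℝ) :=
  {p | p ∈ condPolytope k n ∧
    ∃ (V : Matrix (Fin m) (Fin k) ℝ) (W : Matrix (Fin m) (Fin n) ℝ)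
      (b : Fin n → ℝ) (c : Fin m → ℝ),
      ∀ x y, p x y = crbmWeight V W b c x y / ∑ y' : BinState n, crbmWeight V W b c x y'}

/-- The set `C_{k,n}(d)` of conditional distributions with at most `2^k + d` positive entries. -/
def boundedSupport (k n d : ℕ) : Set (BinState k → BinState n → ℝ) :=
  {p | p ∈ condPolytope k n ∧
    {xy : BinState k × BinState n | 0 < p xy.1 xy.2}.ncard ≤ 2 ^ k + d}

/-- The set of outputs that have positive probability given the input `x`. -/
def positiveOutputs {k n : ℕ} (p : BinState k → BinState n → ℝ) (x : BinState k) :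
    Set (BinState n) :=
  {y | 0 < p x y}

/-- The set of conditional distributions `M` approximates `p` arbitrarily well: for every
tolerance there is an element of `M` each of whose rows is within that tolerance of the
corresponding row of `p` in the `ℓ¹` distance. -/
def ApproximatesArbitrarilyWell {k n : ℕ} (M : Set (BinState k → BinState n → ℝ))
    (p : BinState k → BinState n → ℝ) : Prop :=
  ∀ ε : ℝ, 0 < ε → ∃ q ∈ M, ∀ x, ∑ y, |q x y - p x y| ≤ ε

end

open Filter Topology

/-! Fix an output `y₀` in the common support `S` and rescale each row so that `y₀` has weight one;
normalization undoes this. The output bias gives `y` the factor `exp (-β * y.hamming y₀)`, so as `β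
→ ∞` only `y₀` survives. Each other `y ∈ S` is restored by hidden units, one per edge of the input
cube in the direction of the first bit: an affine function can take arbitrary values at both ends of
an edge and be very negative elsewhere (`unitInput_some`), so one unit serves two inputs. Hence
`(S.card - 1) * 2 ^ (k - 1)` units suffice, at most `d / 2`. The limit is `tendsto_unit_weight`. -/

/-- The Hamming distance of two binary states, as a real number. -/
noncomputable def BinState.hamming {N : ℕ} (x a : BinState N) : ℝ :=
  ∑ i, if x i = a i then 0 else 1

/-- The coefficients of the affine function that maps a binary state to its Hamming distance
from `a`. -/
noncomputable def BinState.slope {N : ℕ} (a : BinState N) : Fin N → ℝ :=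
  fun i => if a i then -1 else 1

theorem BinState.slope_dotProduct {N : ℕ} (a x : BinState N) :
    a.slope ⬝ᵥ x.toVec = x.hamming a - ∑ i, a.toVec i := by
  simp only [dotProduct, BinState.hamming, ← Finset.sum_sub_distrib]
  refine Finset.sum_congr rfl fun i _ => ?_
  cases ha : a i <;> cases hx : x i <;> simp [BinState.slope, BinState.toVec, ha, hx]

theorem BinState.hamming_nonneg {N : ℕ} (x a : BinState N) : 0 ≤ x.hamming a :=
  Finset.sum_nonneg fun i _ => by split_ifs <;> norm_num

theorem BinState.hamming_self {N : ℕ} (x : BinState N) : x.hamming x = 0 := by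
  simp [BinState.hamming]

theorem BinState.one_le_hamming {N : ℕ} {x a : BinState N} (h : x ≠ a) : 1 ≤ x.hamming a := by
  obtain ⟨i, hi⟩ := Function.ne_iff.mp h
  calc (1 : ℝ) = if x i = a i then 0 else 1 := by simp [hi]
    _ ≤ x.hamming a := Finset.single_le_sum (f := fun i => if x i = a i then (0 : ℝ) else 1)
        (fun j _ => by split_ifs <;> norm_num) (Finset.mem_univ i)

theorem BinState.hamming_le {N : ℕ} (x a : BinState N) : x.hamming a ≤ N := by
  calc x.hamming a ≤ ∑ _i : Fin N, (1 : ℝ) :=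
        Finset.sum_le_sum fun i _ => by split_ifs <;> norm_num
    _ = N := by simp

/-- Summing out the hidden units turns the weight into a product over the hidden units. -/
theorem crbmWeight_eq_prod {k n m : ℕ} (V : Matrix (Fin m) (Fin k) ℝ)
    (W : Matrix (Fin m) (Fin n) ℝ) (b : Fin n → ℝ) (c : Fin m → ℝ) (x : BinState k)
    (y : BinState n) :
    crbmWeight V W b c x y = Real.exp (b ⬝ᵥ y.toVec) *
      ∏ j, (1 + Real.exp (V j ⬝ᵥ x.toVec + W j ⬝ᵥ y.toVec + c j)) := by
  have h : ∀ j, 1 + Real.exp (V j ⬝ᵥ x.toVec + W j ⬝ᵥ y.toVec + c j) =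
      ∑ s : Bool,
        Real.exp ((if s then 1 else 0) * (V j ⬝ᵥ x.toVec + W j ⬝ᵥ y.toVec + c j)) := by
    intro j
    simp [add_comm]
  simp only [h]
  rw [Finset.prod_univ_sum, Fintype.piFinset_univ, Finset.mul_sum]
  refine Finset.sum_congr rfl fun z _ => ?_
  rw [← Real.exp_sum, ← Real.exp_add]
  congr 1
  simp only [mul_add, Finset.sum_add_distrib]
  have e1 : z.toVec ⬝ᵥ (V *ᵥ x.toVec) =
      ∑ j, (if z j then 1 else 0) * (V j ⬝ᵥ x.toVec) := rfl
  have e2 : z.toVec ⬝ᵥ (W *ᵥ y.toVec) =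
      ∑ j, (if z j then 1 else 0) * (W j ⬝ᵥ y.toVec) := rfl
  have e3 : c ⬝ᵥ z.toVec = ∑ j, (if z j then 1 else 0) * c j := by
    rw [dotProduct_comm]; rfl
  rw [e1, e2, e3]
  ring

theorem crbmWeight_pos {k n m : ℕ} (V : Matrix (Fin m) (Fin k) ℝ)
    (W : Matrix (Fin m) (Fin n) ℝ) (b : Fin n → ℝ) (c : Fin m → ℝ) (x : BinState k)
    (y : BinState n) : 0 < crbmWeight V W b c x y :=
  Finset.sum_pos (fun _ _ => Real.exp_pos _) Finset.univ_nonempty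

/-- Normalizing the weights gives an element of the machine. -/
theorem crbmWeight_div_sum_mem {k n m : ℕ} (V : Matrix (Fin m) (Fin k) ℝ)
    (W : Matrix (Fin m) (Fin n) ℝ) (b : Fin n → ℝ) (c : Fin m → ℝ) :
    (fun x y => crbmWeight V W b c x y / ∑ y', crbmWeight V W b c x y') ∈ CRBM k n m := by
  have hs : ∀ x, 0 < ∑ y', crbmWeight V W b c x y' := fun x =>
    Finset.sum_pos (fun y _ => crbmWeight_pos V W b c x y) Finset.univ_nonempty
  refine ⟨fun x => ⟨fun y => div_nonneg (crbmWeight_pos V W b c x y).le (hs x).le, ?_⟩,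
    V, W, b, c, fun _ _ => rfl⟩
  rw [← Finset.sum_div, div_self (hs x).ne']

/-- If the weights, up to a common factor, converge to a multiple of `p`, then the machine
approximates `p`. -/
theorem approximates_of_tendsto {k n m : ℕ} {p : BinState k → BinState n → ℝ}
    (hp : p ∈ condPolytope k n) (V : ℝ → Matrix (Fin m) (Fin k) ℝ)
    (W : ℝ → Matrix (Fin m) (Fin n) ℝ) (b : ℝ → Fin n → ℝ) (c : ℝ → Fin m → ℝ)
    (a : ℝ → ℝ) (ha : ∀ β, a β ≠ 0) (r : BinState k → ℝ) (hr : ∀ x, r x ≠ 0)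
    (h : ∀ x y, Tendsto (fun β => a β * crbmWeight (V β) (W β) (b β) (c β) x y) atTop
      (𝓝 (p x y / r x))) :
    ApproximatesArbitrarilyWell (CRBM k n m) p := by
  intro ε hε
  have hlim : ∀ x, Tendsto (fun β => ∑ y, |crbmWeight (V β) (W β) (b β) (c β) x y /
      (∑ y', crbmWeight (V β) (W β) (b β) (c β) x y') - p x y|) atTop (𝓝 0) := by
    intro x
    have hsum : Tendsto (fun β => ∑ y, a β * crbmWeight (V β) (W β) (b β) (c β) x y) atTop
        (𝓝 (1 / r x)) := by
      have := tendsto_finsetSum Finset.univ fun y _ => h x y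
      rwa [← Finset.sum_div, (hp x).2] at this
    have hy : ∀ y, Tendsto (fun β => |crbmWeight (V β) (W β) (b β) (c β) x y /
        (∑ y', crbmWeight (V β) (W β) (b β) (c β) x y') - p x y|) atTop (𝓝 0) := by
      intro y
      -- The row factor `r x` cancels in the limit, and the common factor `a β` cancels before it.
      have h1 := (h x y).div hsum (one_div_ne_zero (hr x))
      rw [div_div_div_cancel_right₀ (hr x), div_one] at h1
      have h2 : Tendsto (fun β => crbmWeight (V β) (W β) (b β) (c β) x y /
          ∑ y', crbmWeight (V β) (W β) (b β) (c β) x y') atTop (𝓝 (p x y)) := by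
        refine h1.congr fun β => ?_
        rw [Pi.div_apply, ← Finset.mul_sum, mul_div_mul_left _ _ (ha β)]
      simpa using (h2.sub_const (p x y)).abs
    simpa using tendsto_finsetSum Finset.univ fun y _ => hy y
  obtain ⟨β, hβ⟩ := (eventually_all.mpr fun x => (hlim x).eventually_le_const hε).exists
  exact ⟨_, crbmWeight_div_sum_mem (V β) (W β) (b β) (c β), hβ⟩

section Units

variable {k n : ℕ} (t : BinState (k + 1) → BinState n → ℝ) (y₀ : BinState n)

/-- The input weights of the hidden unit that, given an input agreeing with `a.2` after its
first bit, raises the weight of the output `a.1`. The value `none` stands for an idle unit. -/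
noncomputable def unitV (β : ℝ) : Option (BinState n × BinState k) → Fin (k + 1) → ℝ
  | none => 0
  | some a => Fin.cons
      -- The first bit interpolates between the prescribed logarithms at the two ends of the edge.
      (Real.log (t (Fin.cons true a.2) a.1) - Real.log (t (Fin.cons false a.2) a.1))
      (-(β * (n + 1)) • a.2.slope)

/-- The output weights of the hidden unit described in `unitV`. -/
noncomputable def unitW (β : ℝ) : Option (BinState n × BinState k) → Fin n → ℝ
  | none => 0
  | some a => -(β * (n + 1)) • a.1.slope

/-- The bias of the hidden unit described in `unitV`. -/
noncomputable def unitC (β : ℝ) : Option (BinState n × BinState k) → ℝ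
  | none => -β
  -- The Hamming term offsets the decay caused by the output bias; the subtracted sums turn the
  -- slopes into Hamming distances.
  | some a => Real.log (t (Fin.cons false a.2) a.1) + β * a.1.hamming y₀
      - β * (n + 1) * (∑ i, a.2.toVec i + ∑ i, a.1.toVec i)

/-- The total input received by the hidden unit described in `unitV`. -/
noncomputable def unitInput (β : ℝ) (o : Option (BinState n × BinState k)) (x : BinState (k + 1))
    (y : BinState n) : ℝ :=
  unitV t β o ⬝ᵥ x.toVec + unitW β o ⬝ᵥ y.toVec + unitC t y₀ β o

theorem unitInput_some (β : ℝ) (a : BinState n × BinState k) (x : BinState (k + 1))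
    (y : BinState n) :
    unitInput t y₀ β (some a) x y =
      Real.log (t (Fin.cons (x 0) a.2) a.1) + β * a.1.hamming y₀
        - β * (n + 1) * (BinState.hamming (Fin.tail x) a.2 + y.hamming a.1) := by
  have hV : unitV t β (some a) ⬝ᵥ x.toVec =
      (Real.log (t (Fin.cons true a.2) a.1) - Real.log (t (Fin.cons false a.2) a.1)) *
        (if x 0 then 1 else 0) + (-(β * (n + 1)) • a.2.slope) ⬝ᵥ
          BinState.toVec (Fin.tail x) := by
    rw [dotProduct, Fin.sum_univ_succ]
    simp only [unitV, dotProduct, BinState.toVec, Fin.tail, Fin.cons_zero, Fin.cons_succ]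
    rfl
  rw [unitInput, hV]
  simp only [unitW, unitC, smul_dotProduct, BinState.slope_dotProduct, smul_eq_mul]
  cases x 0 <;> simp <;> ring

/-- A hidden unit is switched off away from the two states it is responsible for. -/
theorem tendsto_exp_unitInput_zero (o : Option (BinState n × BinState k))
    (x : BinState (k + 1)) (y : BinState n) (h : o ≠ some (y, Fin.tail x)) :
    Tendsto (fun β => Real.exp (unitInput t y₀ β o x y)) atTop (𝓝 0) := by
  refine Real.tendsto_exp_atBot.comp ?_
  rcases o with _ | a
  · simpa [unitInput, unitV, unitW, unitC] using tendsto_neg_atTop_atBot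
  · have hD : 1 ≤ BinState.hamming (Fin.tail x) a.2 + y.hamming a.1 := by
      by_cases hy : y = a.1
      · have hx : Fin.tail x ≠ a.2 := by
          rintro hx
          exact h (by rw [hy, hx])
        linarith [BinState.one_le_hamming hx, BinState.hamming_nonneg y a.1]
      · linarith [BinState.one_le_hamming hy, BinState.hamming_nonneg (Fin.tail x) a.2]
    refine tendsto_atBot_mono' atTop ?_ (tendsto_atBot_add_const_left atTop
      (Real.log (t (Fin.cons (x 0) a.2) a.1)) tendsto_neg_atTop_atBot)
    filter_upwards [eventually_ge_atTop 0] with β hβ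
    rw [unitInput_some]
    -- The boost is at most `β * n` and the penalty at least `β * (n + 1)`, which leaves at most
    -- `-β` beside the logarithm.
    have h1 : β * a.1.hamming y₀ ≤ β * n :=
      mul_le_mul_of_nonneg_left (BinState.hamming_le _ _) hβ
    have h2 : β * (n + 1) * 1 ≤
        β * (n + 1) * (BinState.hamming (Fin.tail x) a.2 + y.hamming a.1) :=
      mul_le_mul_of_nonneg_left hD (by positivity)
    linarith

theorem exp_unitInput_eq (β : ℝ) (x : BinState (k + 1)) (y : BinState n) (ht : 0 < t x y) :
    Real.exp (unitInput t y₀ β (some (y, Fin.tail x)) x y) =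
      t x y * Real.exp (β * y.hamming y₀) := by
  rw [unitInput_some]
  simp only [BinState.hamming_self, Fin.cons_self_tail]
  rw [add_zero, mul_zero, sub_zero, Real.exp_add, Real.exp_log ht]

theorem tendsto_exp_neg_mul_hamming {y : BinState n} (h : y ≠ y₀) :
    Tendsto (fun β : ℝ => Real.exp (-(β * y.hamming y₀))) atTop (𝓝 0) :=
  Real.tendsto_exp_neg_atTop_nhds_zero.comp
    (tendsto_id.atTop_mul_const (by linarith [BinState.one_le_hamming h]))

/-- The rescaled weights converge to `t`, provided that the output `y₀` has weight one and that
every other output of positive weight is served by a unique hidden unit for every choice of the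
input bits after the first. -/
theorem tendsto_unit_weight {m : ℕ} (g : Fin m → Option (BinState n × BinState k))
    (x : BinState (k + 1)) (y : BinState n) (h₀ : t x y₀ = 1)
    (hidle : (y = y₀ ∨ t x y = 0) → ∀ j, g j ≠ some (y, Fin.tail x))
    (hunit : y ≠ y₀ → t x y ≠ 0 →
      0 < t x y ∧ ∃ j, g j = some (y, Fin.tail x) ∧
        ∀ j', j' ≠ j → g j' ≠ some (y, Fin.tail x)) :
    Tendsto (fun β => Real.exp (-(β * y.hamming y₀)) *
      ∏ j, (1 + Real.exp (unitInput t y₀ β (g j) x y))) atTop (𝓝 (t x y)) := by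
  have hoff : ∀ j, g j ≠ some (y, Fin.tail x) →
      Tendsto (fun β => 1 + Real.exp (unitInput t y₀ β (g j) x y)) atTop (𝓝 1) := fun j hj => by
    simpa using (tendsto_exp_unitInput_zero t y₀ (g j) x y hj).const_add 1
  by_cases hc : y = y₀ ∨ t x y = 0
  -- Every unit is off, so the bias factor alone decides: it is one at `y₀` and vanishes in the
  -- limit elsewhere.
  · have hprod := tendsto_finsetProd Finset.univ fun j _ => hoff j (hidle hc j)
    rw [Finset.prod_const_one] at hprod
    by_cases hy : y = y₀
    · subst hy
      simpa [BinState.hamming_self, h₀] using hprod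
    · rw [hc.resolve_left hy]
      simpa using (tendsto_exp_neg_mul_hamming y₀ hy).mul hprod
  · obtain ⟨hy, hty⟩ := not_or.mp hc
    obtain ⟨hpos, j, hj, hj'⟩ := hunit hy hty
    have hprod := tendsto_finsetProd (Finset.univ.erase j) fun i hi =>
      hoff i (hj' i (Finset.ne_of_mem_erase hi))
    rw [Finset.prod_const_one] at hprod
    -- The decay kills the summand `1` and exactly cancels the boost in the exponential, leaving `t
    -- x y`.
    have hmain : Tendsto (fun β => Real.exp (-(β * y.hamming y₀)) *
        (1 + Real.exp (unitInput t y₀ β (g j) x y))) atTop (𝓝 (t x y)) := by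
      have := (tendsto_exp_neg_mul_hamming y₀ hy).add_const (t x y)
      rw [zero_add] at this
      refine this.congr fun β => ?_
      rw [hj, exp_unitInput_eq t y₀ β x y hpos, mul_add, mul_one, mul_left_comm,
        ← Real.exp_add, neg_add_cancel, Real.exp_zero, mul_one]
    have := hmain.mul hprod
    rw [mul_one] at this
    refine this.congr fun β => ?_
    rw [mul_assoc, Finset.mul_prod_erase _ (fun j => 1 + Real.exp (unitInput t y₀ β (g j) x y))
      (Finset.mem_univ j)]

end Units

/-- A conditional distribution whose rows are all supported on `S` is approximated as soon as there
is a hidden unit for every output in `S` but one and every edge of a perfect matching of the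
input cube. -/
theorem approximates_of_common_support {k n m : ℕ} {p : BinState (k + 1) → BinState n → ℝ}
    (hp : p ∈ condPolytope (k + 1) n) (S : Finset (BinState n))
    (hS : ∀ x y, 0 < p x y ↔ y ∈ S) (hm : (S.card - 1) * 2 ^ k ≤ m) :
    ApproximatesArbitrarilyWell (CRBM (k + 1) n m) p := by
  classical
  have hzero : ∀ x y, y ∉ S → p x y = 0 := fun x y hy =>
    le_antisymm (not_lt.mp fun h => hy ((hS x y).mp h)) ((hp x).1 y)
  obtain ⟨y₀, hy₀⟩ : S.Nonempty := by
    by_contra hne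
    rw [Finset.not_nonempty_iff_eq_empty] at hne
    have h1 := (hp fun _ => false).2
    rw [Finset.sum_eq_zero fun y _ => hzero _ y (by simp [hne])] at h1
    exact zero_ne_one h1
  have hr : ∀ x, 0 < p x y₀ := fun x => (hS x y₀).mpr hy₀
  have hcard : Fintype.card ((S.erase y₀ ×ˢ (Finset.univ : Finset (BinState k)) :
      Finset (BinState n × BinState k))) ≤ Fintype.card (Fin m) := by
    rw [Fintype.card_coe, Finset.card_product, Finset.card_erase_of_mem hy₀]
    simpa using hm
  obtain ⟨e⟩ := Function.Embedding.nonempty_of_card_le hcard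
  -- Units outside the range of `e` stay idle.
  let g : Fin m → Option (BinState n × BinState k) := fun j =>
    (Function.partialInv e j).map Subtype.val
  have hg : ∀ j a, g j = some a ↔ ∃ h : a ∈ S.erase y₀ ×ˢ (Finset.univ : Finset (BinState k)),
      e ⟨a, h⟩ = j := by
    intro j a
    simp only [g, Option.map_eq_some_iff]
    constructor
    · rintro ⟨⟨a', h'⟩, h1, rfl⟩
      exact ⟨h', (e.injective.isPartialInv _ _).mp h1⟩
    · rintro ⟨h, h1⟩
      exact ⟨⟨a, h⟩, (e.injective.isPartialInv _ _).mpr h1, rfl⟩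
  let t : BinState (k + 1) → BinState n → ℝ := fun x y => p x y / p x y₀
  have ht : ∀ x y, y ∈ S → 0 < t x y := fun x y hy => div_pos ((hS x y).mpr hy) (hr x)
  refine approximates_of_tendsto hp (fun β => Matrix.of fun j => unitV t β (g j))
    (fun β => Matrix.of fun j => unitW β (g j))
    (fun β => -β • y₀.slope) (fun β j => unitC t y₀ β (g j))
    -- This factor supplies the constant by which the output bias differs from `-β` times the
    -- Hamming distance to `y₀`.
    (fun β => Real.exp (-(β * ∑ i, y₀.toVec i))) (fun β => Real.exp_ne_zero _)
    (fun x => p x y₀) (fun x => (hr x).ne') fun x y => ?_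
  refine (tendsto_unit_weight t y₀ g x y (div_self (hr x).ne') ?_ ?_).congr fun β => ?_
  · intro hc j hj
    obtain ⟨hmem, -⟩ := (hg _ _).mp hj
    obtain ⟨hne, hyS⟩ := Finset.mem_erase.mp (Finset.mem_product.mp hmem).1
    exact hc.elim hne (ht x y hyS).ne'
  · intro hy hty
    have hyS : y ∈ S := by
      by_contra hyS
      exact hty (by simp [t, hzero x y hyS])
    have hmem : (y, Fin.tail x) ∈ S.erase y₀ ×ˢ (Finset.univ : Finset (BinState k)) := by
      simp [hy, hyS]
    refine ⟨ht x y hyS, e ⟨_, hmem⟩, (hg _ _).mpr ⟨hmem, rfl⟩, fun j' hj' h => ?_⟩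
    obtain ⟨_, h1⟩ := (hg _ _).mp h
    exact hj' h1.symm
  · rw [crbmWeight_eq_prod, ← mul_assoc, ← Real.exp_add, smul_dotProduct,
      BinState.slope_dotProduct, smul_eq_mul]
    have h1 : -(β * ∑ i, y₀.toVec i) + -β * (y.hamming y₀ - ∑ i, y₀.toVec i) =
        -(β * y.hamming y₀) := by ring
    rw [h1]
    rfl

theorem mainTheorem9 (k n m d : ℕ) (hk : 1 ≤ k) (hd : 2 ^ k ∣ d) (hm : (d : ℝ) / 2 ≤ (m : ℝ))
    (p : BinState k → BinState n → ℝ) (hp : p ∈ boundedSupport k n d)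
    (hsupp : ∀ x x' : BinState k, positiveOutputs p x = positiveOutputs p x') :
    ApproximatesArbitrarilyWell (CRBM k n m) p := by
  classical
  obtain ⟨k, rfl⟩ : ∃ l, k = l + 1 := ⟨k - 1, by omega⟩
  obtain ⟨r, rfl⟩ := hd
  obtain ⟨hpoly, hcard⟩ := hp
  let S : Finset (BinState n) := (positiveOutputs p fun _ => false).toFinset
  have hS : ∀ x y, 0 < p x y ↔ y ∈ S := by
    intro x y
    rw [Set.mem_toFinset, hsupp _ x]
    rfl
  have hset : {xy : BinState (k + 1) × BinState n | 0 < p xy.1 xy.2} =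
      ((Finset.univ ×ˢ S : Finset (BinState (k + 1) × BinState n)) : Set _) := by
    ext xy
    simp [hS]
  rw [hset, Set.ncard_coe_finset, Finset.card_product] at hcard
  have hSr : S.card ≤ 1 + r := by
    -- All rows share the support `S`, so the bound on positive entries can be divided by the number
    -- of inputs.
    have h1 : 2 ^ (k + 1) * S.card ≤ 2 ^ (k + 1) * (1 + r) := by
      simpa [mul_add] using hcard
    exact Nat.le_of_mul_le_mul_left h1 (by positivity)
  refine approximates_of_common_support hpoly S hS ?_
  have hrm : r * 2 ^ k ≤ m := by
    have h1 : ((r * 2 ^ k : ℕ) : ℝ) ≤ m := by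
      refine le_trans (le_of_eq ?_) hm
      push_cast
      ring
    exact_mod_cast h1
  exact (Nat.mul_le_mul_right _ (by omega)).trans hrm
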